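/- **Lemma 4.2.** Let $(X_t)_{t\in\mathbb R}$ be a stationary Markov process with càdlàg sample paths in the finite set $E=\{1,\dots,d\}$, defined on a probability space $(\Omega,\mathcal F,\mathbf P)$, with transition intensities matrix $\Lambda=(\lambda_{ij})_{i,j\in E}$ (so $\lambda_{ij}\ge 0$ for $i\neq j$, $\sum_j\lambda_{ij}=0$, and $\mathbf P(X_t=j\mid \sigma\{X_r:r\le s\})=(e^{(t-s)\Lambda})_{X_s j}$ a.s. for $s\le t$) and with stationary measure $\pi_i=\mathbf P(X_t=i)$ satisfying $\pi_i>0$ for all $i\in E$. Let $h:E\to\mathbb R^n$ be an observation function, $h_i=h(i)$. The model is called *invertible* if for all $s\le t$ the random variable $X_t$ coincides $\mathbf P$-a.s. with a random variable that is measurable with respect to $\sigma(X_s)\vee\sigma\{h(X_r):r\in[s,t]\}$. The model is invertible if and only if both of the following hold: 1. for all $i\ne j$ with $\lambda_{ij}>0$, we have $h_i\neq h_j$; 2. for all pairwise distinct $i,j,k$ with $\lambda_{ij}>0$ and $\lambda_{ik}>0$, we have $h_j\neq h_k$. -/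

import Mathlib

open MeasureTheory ProbabilityTheory Filter Topology

namespace FilteringModel

/-- The sigma-field generated by the random variables `Z r` with `r ∈ I`. -/
abbrev pathSigma {Ω S : Type*} [mS : MeasurableSpace S] (Z : ℝ → Ω → S) (I : Set ℝ) :
    MeasurableSpace Ω :=
  ⨆ r ∈ I, mS.comap (Z r)

/-- Càdlàg: right continuous at every time, with a left limit at every time. -/
def IsCadlag {S : Type*} [TopologicalSpace S] (x : ℝ → S) : Prop :=
  ∀ t, ContinuousWithinAt x (Set.Ici t) t ∧ ∃ l, Tendsto x (𝓝[<] t) (𝓝 l)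

/-- The model with signal `X` and observation function `h` is invertible: for all `s ≤ t`, the
random variable `X t` is almost surely equal to one that is measurable with respect to the
sigma-field generated by `X s` and by the noiseless observations `h (X r)`, `r ∈ [s, t]`. -/
def IsInvertible {Ω E S : Type*} [MeasurableSpace Ω] [mE : MeasurableSpace E] [MeasurableSpace S]
    (P : Measure Ω) (X : ℝ → Ω → E) (h : E → S) : Prop :=
  ∀ s t : ℝ, s ≤ t → ∃ Z : Ω → E,
    Measurable[mE.comap (X s) ⊔ pathSigma (fun r ω => h (X r ω)) (Set.Icc s t)] Z ∧
      X t =ᵐ[P] Z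

/-- Transition intensities matrices: nonnegative off the diagonal, with rows summing to zero. -/
structure IsIntensityMatrix {d : ℕ} (Λ : Matrix (Fin d) (Fin d) ℝ) : Prop where
  nonneg : ∀ i j, i ≠ j → 0 ≤ Λ i j
  row_sum : ∀ i, ∑ j, Λ i j = 0

/-- `X` is a stationary Markov process indexed by `ℝ`, with values in the finite set `Fin d` and
càdlàg paths, with transition intensities matrix `Λ` and with stationary measure `π`, which
charges every point. The transition probabilities over a time span `u ≥ 0` are the entries of the
matrix `exp (u Λ)`, and the Markov property is with respect to the past of `X`. -/
structure IsStationaryFiniteMarkov {Ω : Type*} [MeasurableSpace Ω] (P : Measure Ω) {d : ℕ}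
    (X : ℝ → Ω → Fin d) (Λ : Matrix (Fin d) (Fin d) ℝ) (π : Fin d → ℝ) : Prop where
  measurable : ∀ t, Measurable (X t)
  cadlag : ∀ ω, IsCadlag fun t => X t ω
  intensity : IsIntensityMatrix Λ
  pos : ∀ i, 0 < π i
  stationary : ∀ t i, P.real (X t ⁻¹' {i}) = π i
  markov : ∀ s t, s ≤ t → ∀ j,
    P⟦X t ⁻¹' {j} | pathSigma X (Set.Iic s)⟧ =ᵐ[P]
      fun ω => NormedSpace.exp ((t - s) • Λ) (X s ω) j

end FilteringModel

/-!
Everything is read off the skeletons of the signal along the dyadic subdivisions of `[s, t]`: the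
Markov property gives the law of a skeleton as a product of entries of `exp (u Λ)`
(`IsStationaryFiniteMarkov.measureReal_gridPath`), and the only analytic fact about these entries
is the expansion `exp (u Λ) = 1 + u Λ + O(u²)` (`exists_abs_exp_smul_apply_sub_le`). Neither jump
times nor their densities are needed.

If the two conditions hold, the signal is recovered by decoding the skeleton step by step: as long
as the observation does not change, the state does not change either, and a new observation
identifies the new state among those that can be reached by one jump (`decode_eq`). This is correct
unless some step joins two distinct states `i`, `j` with `Λ i j = 0`, which has probability `O(u²)`
for each of the steps of length `u`, hence `O(2⁻ⁿ)` at level `n`. By the Borel–Cantelli lemma the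
decoded state is almost surely equal to `X t` at all fine enough levels
(`IsStationaryFiniteMarkov.isInvertible`).

If one of the conditions fails, there are two kinds of paths over a short time span that lead to
different final states: either one jump from `i` to `j` or no jump at all, where `h i = h j`, or one
jump from `i` to `j` or one from `i` to `k`, where `h j = h k`. Along a grid, paths of the two kinds
with equal observations have comparable probabilities, uniformly in the mesh. An event of the grid
observations contains or misses such paths simultaneously (`measureReal_inter_gridPath_le`), so
that `P (G ∩ B) ≤ C * P (G ∩ B')` for all events `G` of the grid observations, where `B` and `B'`
are the events that a path of the first or the second kind occurs. This extends to all
observations, because an algebra of events is dense in the sigma-field that it generates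
(`measureReal_inter_le_of_measurableSet_iSup`) and because paths are right continuous
(`comap_sup_pathSigma_le_iSup_dyadicObs`). If `X t` were equal to an observable `Z`, the event
`Z = j` would have a null intersection with `B'` but would contain almost all of `B`, which has
positive probability (`not_isInvertible_of_le`).
-/

namespace FilteringModel

/-! ### Short-time behaviour of the matrix exponential -/

theorem isBigO_exp_sub_one_sub_id {A : Type*} [NormedRing A] [NormedAlgebra ℝ A]
    [CompleteSpace A] :
    (fun y : A => NormedSpace.exp y - 1 - y) =O[𝓝 0] fun y => ‖y‖ ^ 2 := by
  refine ((NormedSpace.exp_hasFPowerSeriesAt_zero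
    (𝕂 := ℝ) (𝔸 := A)).isBigO_sub_partialSum_pow 2).congr_left fun y => ?_
  simp [FormalMultilinearSeries.partialSum, Finset.sum_range_succ, sub_sub,
    NormedSpace.expSeries_apply_eq]

section Exponential

attribute [local instance] Matrix.linftyOpNormedRing Matrix.linftyOpNormedAlgebra

/-- First order expansion of the semigroup `exp (u Λ)`, entry by entry, with an error `O(u²)`. -/
theorem exists_abs_exp_smul_apply_sub_le {d : ℕ} (Λ : Matrix (Fin d) (Fin d) ℝ) :
    ∃ K > 0, ∃ δ > 0, ∀ u : ℝ, 0 ≤ u → u ≤ δ → ∀ i j,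
      |NormedSpace.exp (u • Λ) i j - (1 : Matrix (Fin d) (Fin d) ℝ) i j - u * Λ i j|
        ≤ K * u ^ 2 := by
  have hO := isBigO_exp_sub_one_sub_id (A := Matrix (Fin d) (Fin d) ℝ)
  have hlim : Tendsto (fun u : ℝ => u • Λ) (𝓝 0) (𝓝 0) := by
    have : Continuous fun u : ℝ => u • Λ := by fun_prop
    simpa using this.tendsto 0
  have hsq : ((fun A : Matrix (Fin d) (Fin d) ℝ => ‖A‖ ^ 2) ∘ fun u : ℝ => u • Λ)
      =O[𝓝 0] fun u : ℝ => u ^ 2 := by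
    refine Asymptotics.IsBigO.of_bound (‖Λ‖ ^ 2) (Eventually.of_forall fun u => le_of_eq ?_)
    simp only [Function.comp, norm_smul, norm_pow, norm_mul, norm_norm, mul_pow]
    rw [mul_comm]
  have hO1 := (hO.comp_tendsto hlim).trans hsq
  have hO2 : ∀ i j, (fun u : ℝ => NormedSpace.exp (u • Λ) i j
      - (1 : Matrix (Fin d) (Fin d) ℝ) i j - u * Λ i j) =O[𝓝 0] fun u : ℝ => u ^ 2 := by
    intro i j
    have h1 := ((LinearMap.toContinuousLinearMap
      (Matrix.entryLinearMap ℝ ℝ i j : Matrix (Fin d) (Fin d) ℝ →ₗ[ℝ] ℝ)).isBigO_comp _ _).trans hO1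
    exact h1.congr_left fun u => rfl
  choose C hC hb using fun p : Fin d × Fin d => (hO2 p.1 p.2).exists_pos
  have hev : ∀ᶠ u : ℝ in 𝓝 0, ∀ p : Fin d × Fin d,
      ‖NormedSpace.exp (u • Λ) p.1 p.2 - (1 : Matrix (Fin d) (Fin d) ℝ) p.1 p.2 - u * Λ p.1 p.2‖
        ≤ C p * ‖u ^ 2‖ := eventually_all.2 fun p => (hb p).bound
  obtain ⟨δ, hδ, hball⟩ := Metric.eventually_nhds_iff.1 hev
  have hpos : 0 ≤ ∑ p, C p := Finset.sum_nonneg fun p _ => (hC p).le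
  refine ⟨∑ p, C p + 1, by positivity, δ / 2, by positivity, fun u hu huδ i j => ?_⟩
  have h1 := hball (y := u) (by rw [Real.dist_eq, sub_zero, abs_of_nonneg hu]; linarith) (i, j)
  have h2 : C (i, j) ≤ ∑ p, C p :=
    Finset.single_le_sum (f := C) (fun p _ => (hC p).le) (Finset.mem_univ _)
  rw [Real.norm_eq_abs, Real.norm_eq_abs, abs_of_nonneg (sq_nonneg u)] at h1
  refine h1.trans ?_
  gcongr
  linarith

end Exponential

/-! ### Path probabilities along a time grid -/

theorem comap_le_pathSigma {Ω S : Type*} [mS : MeasurableSpace S] (Z : ℝ → Ω → S) {I : Set ℝ}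
    {r : ℝ} (hr : r ∈ I) : mS.comap (Z r) ≤ pathSigma Z I :=
  le_iSup₂ (f := fun r (_ : r ∈ I) => mS.comap (Z r)) r hr

theorem pathSigma_mono {Ω S : Type*} [MeasurableSpace S] (Z : ℝ → Ω → S) {I J : Set ℝ}
    (hIJ : I ⊆ J) : pathSigma Z I ≤ pathSigma Z J :=
  iSup₂_le fun _ hr => comap_le_pathSigma Z (hIJ hr)

theorem pathSigma_le {Ω S : Type*} [mΩ : MeasurableSpace Ω] [MeasurableSpace S] {Z : ℝ → Ω → S}
    (hZ : ∀ r, Measurable (Z r)) (I : Set ℝ) : pathSigma Z I ≤ mΩ :=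
  iSup₂_le fun r _ => (hZ r).comap_le

theorem measurableSet_pathSigma_preimage {Ω S : Type*} [MeasurableSpace S] (Z : ℝ → Ω → S)
    {I : Set ℝ} {r : ℝ} (hr : r ∈ I) {A : Set S} (hA : MeasurableSet A) :
    MeasurableSet[pathSigma Z I] (Z r ⁻¹' A) :=
  comap_le_pathSigma Z hr _ ⟨A, hA, rfl⟩

/-- The event that `X` visits the states `y 0, …, y N` at the times `s, s + u, …, s + N u`. -/
def gridPath {Ω : Type*} {d : ℕ} (X : ℝ → Ω → Fin d) (s u : ℝ) (N : ℕ) (y : ℕ → Fin d) : Set Ω :=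
  {ω | ∀ l ≤ N, X (s + l * u) ω = y l}

theorem measurableSet_gridPath {Ω : Type*} {d : ℕ} (X : ℝ → Ω → Fin d) (s : ℝ) {u : ℝ} (hu : 0 ≤ u) (N : ℕ)
    (y : ℕ → Fin d) :
    MeasurableSet[pathSigma X (Set.Iic (s + N * u))] (gridPath X s u N y) := by
  have : gridPath X s u N y = ⋂ l : ℕ, ⋂ (_ : l ≤ N), X (s + l * u) ⁻¹' {y l} := by
    ext ω; simp [gridPath]
  rw [this]
  refine MeasurableSet.iInter fun l => MeasurableSet.iInter fun hl => ?_
  refine measurableSet_pathSigma_preimage X ?_ (MeasurableSet.singleton _)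
  have : (l : ℝ) ≤ N := by exact_mod_cast hl
  simp only [Set.mem_Iic]
  gcongr

section Markov

variable {Ω : Type*} [MeasurableSpace Ω] {P : Measure Ω} [IsProbabilityMeasure P] {d : ℕ}
  {X : ℝ → Ω → Fin d} {Λ : Matrix (Fin d) (Fin d) ℝ} {π : Fin d → ℝ}

/-- The Markov property, integrated over an event `A` of the past. -/
theorem IsStationaryFiniteMarkov.measureReal_inter_transition
    (hX : IsStationaryFiniteMarkov P X Λ π) {s t : ℝ} (hst : s ≤ t) {A : Set Ω}
    (hA : MeasurableSet[pathSigma X (Set.Iic s)] A) (i j : Fin d) :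
    P.real (A ∩ X s ⁻¹' {i} ∩ X t ⁻¹' {j})
      = P.real (A ∩ X s ⁻¹' {i}) * NormedSpace.exp ((t - s) • Λ) i j := by
  have hm := pathSigma_le hX.measurable (Set.Iic s)
  have hj : MeasurableSet (X t ⁻¹' {j}) := hX.measurable t (MeasurableSet.singleton j)
  have hB : MeasurableSet[pathSigma X (Set.Iic s)] (A ∩ X s ⁻¹' {i}) :=
    hA.inter (measurableSet_pathSigma_preimage X Set.self_mem_Iic (MeasurableSet.singleton i))
  have h1 := setIntegral_condExp (μ := P) hm
    (f := (X t ⁻¹' {j}).indicator fun _ => (1 : ℝ)) ((integrable_const 1).indicator hj) hB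
  have h2 : ∫ ω in A ∩ X s ⁻¹' {i}, (P⟦X t ⁻¹' {j} | pathSigma X (Set.Iic s)⟧) ω ∂P
      = ∫ _ in A ∩ X s ⁻¹' {i}, NormedSpace.exp ((t - s) • Λ) i j ∂P := by
    refine setIntegral_congr_ae (hm _ hB) ?_
    filter_upwards [hX.markov s t hst j] with ω hω hωB
    rw [hω, show X s ω = i from hωB.2]
  rw [h2, setIntegral_const, setIntegral_indicator hj, setIntegral_const] at h1
  simpa using h1.symm

/-- The law of the skeleton `X s, X (s + u), …, X (s + N u)`. -/
theorem IsStationaryFiniteMarkov.measureReal_gridPath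
    (hX : IsStationaryFiniteMarkov P X Λ π) (s : ℝ) {u : ℝ} (hu : 0 ≤ u) (N : ℕ)
    (y : ℕ → Fin d) :
    P.real (gridPath X s u N y)
      = π (y 0) * ∏ l ∈ Finset.range N, NormedSpace.exp (u • Λ) (y l) (y (l + 1)) := by
  induction N with
  | zero =>
    have : gridPath X s u 0 y = X s ⁻¹' {y 0} := by ext ω; simp [gridPath]
    simp [this, hX.stationary]
  | succ N ih =>
    have hsub : gridPath X s u N y ∩ X (s + N * u) ⁻¹' {y N} = gridPath X s u N y :=
      Set.inter_eq_left.2 fun ω hω => hω N le_rfl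
    have hset : gridPath X s u (N + 1) y = gridPath X s u N y ∩ X (s + N * u) ⁻¹' {y N}
        ∩ X (s + (N + 1 : ℕ) * u) ⁻¹' {y (N + 1)} := by
      rw [hsub]
      ext ω
      simp [gridPath, Nat.le_add_one_iff, or_imp, forall_and]
    have hle : s + N * u ≤ s + (N + 1 : ℕ) * u := by push_cast; linarith
    rw [hset, hX.measureReal_inter_transition hle (measurableSet_gridPath X s hu N y), hsub, ih,
      Finset.prod_range_succ, mul_assoc,
      show s + ((N + 1 : ℕ) : ℝ) * u - (s + N * u) = u by push_cast; ring]

theorem IsStationaryFiniteMarkov.measureReal_transition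
    (hX : IsStationaryFiniteMarkov P X Λ π) {s t : ℝ} (hst : s ≤ t) (i j : Fin d) :
    P.real (X s ⁻¹' {i} ∩ X t ⁻¹' {j}) = π i * NormedSpace.exp ((t - s) • Λ) i j := by
  have h := hX.measureReal_inter_transition hst MeasurableSet.univ i j
  rwa [Set.univ_inter, hX.stationary] at h

theorem IsStationaryFiniteMarkov.stationary_le_one (hX : IsStationaryFiniteMarkov P X Λ π)
    (i : Fin d) : π i ≤ 1 :=
  hX.stationary 0 i ▸ measureReal_le_one

theorem IsStationaryFiniteMarkov.exp_nonneg (hX : IsStationaryFiniteMarkov P X Λ π) {u : ℝ}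
    (hu : 0 ≤ u) (i j : Fin d) : 0 ≤ NormedSpace.exp (u • Λ) i j := by
  have h := hX.measureReal_transition hu i j
  rw [sub_zero] at h
  exact nonneg_of_mul_nonneg_right (h ▸ measureReal_nonneg) (hX.pos i)

theorem IsStationaryFiniteMarkov.exp_le_one (hX : IsStationaryFiniteMarkov P X Λ π) {u : ℝ}
    (hu : 0 ≤ u) (i j : Fin d) : NormedSpace.exp (u • Λ) i j ≤ 1 := by
  have h := hX.measureReal_transition hu i j
  rw [sub_zero] at h
  refine le_of_mul_le_mul_left ?_ (hX.pos i)
  rw [← h, mul_one, ← hX.stationary 0 i]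
  exact measureReal_mono Set.inter_subset_left

end Markov

/-- The `l`-th point of the subdivision of `[s, t]` into `2 ^ n` intervals of equal length. -/
noncomputable def dyadicTime (s t : ℝ) (n l : ℕ) : ℝ := s + l * ((t - s) / 2 ^ n)

theorem dyadicTime_zero (s t : ℝ) (n : ℕ) : dyadicTime s t n 0 = s := by simp [dyadicTime]

theorem dyadicTime_two_pow (s t : ℝ) (n : ℕ) : dyadicTime s t n (2 ^ n) = t := by
  simp [dyadicTime]; field_simp; ring

theorem dyadicTime_succ_two_mul (s t : ℝ) (n l : ℕ) :
    dyadicTime s t (n + 1) (2 * l) = dyadicTime s t n l := by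
  simp [dyadicTime, pow_succ]; field_simp

theorem dyadicTime_mem_Icc {s t : ℝ} (hst : s ≤ t) {n l : ℕ} (hl : l ≤ 2 ^ n) :
    dyadicTime s t n l ∈ Set.Icc s t := by
  have h0 : 0 ≤ (t - s) / 2 ^ n := div_nonneg (sub_nonneg.2 hst) (by positivity)
  have hl' : (l : ℝ) ≤ ((2 ^ n : ℕ) : ℝ) := by exact_mod_cast hl
  refine ⟨by unfold dyadicTime; nlinarith [mul_nonneg (Nat.cast_nonneg (α := ℝ) l) h0], ?_⟩
  calc dyadicTime s t n l ≤ dyadicTime s t n (2 ^ n) := by unfold dyadicTime; gcongr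
    _ = t := dyadicTime_two_pow s t n

/-! ### Recovering the signal from the observations -/

/-- The new state guessed from the former state `i` and the new observation `x`: the state does
not move if `x = h i`, and otherwise moves to some `j` with `h j = x` that can be reached from `i`
by one jump. If there is no such `j`, the value `i` is a default. -/
noncomputable def decodeStep {d : ℕ} {S : Type*} (Λ : Matrix (Fin d) (Fin d) ℝ) (h : Fin d → S)
    (i : Fin d) (x : S) : Fin d :=
  open Classical in
  if hx : x ≠ h i ∧ ∃ j, 0 < Λ i j ∧ h j = x then hx.2.choose else i

/-- The state guessed after the observations `x 1, …, x l`, from the initial state `i`. -/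
noncomputable def decode {d : ℕ} {S : Type*} (Λ : Matrix (Fin d) (Fin d) ℝ) (h : Fin d → S)
    (i : Fin d) (x : ℕ → S) : ℕ → Fin d
  | 0 => i
  | l + 1 => decodeStep Λ h (decode Λ h i x l) (x (l + 1))

theorem measurable_decodeStep {d : ℕ} {S : Type*} [MeasurableSpace S] [MeasurableSingletonClass S]
    (Λ : Matrix (Fin d) (Fin d) ℝ) (h : Fin d → S) :
    Measurable fun p : Fin d × S => decodeStep Λ h p.1 p.2 := by
  refine measurable_from_prod_countable_right fun i => ?_
  -- Outside the finite range of `h`, the map is constant.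
  refine (measurable_const (a := i)).measurable_of_countable_ne ?_
  refine (Set.finite_range h).countable.mono fun x hx => ?_
  by_contra hne
  refine hx ?_
  simp only [decodeStep]
  rw [dif_neg]
  rintro ⟨-, j, -, hj⟩
  exact hne ⟨j, hj⟩

theorem measurable_decode {d : ℕ} {S T : Type*} [MeasurableSpace S] [MeasurableSingletonClass S]
    {m : MeasurableSpace T} (Λ : Matrix (Fin d) (Fin d) ℝ) (h : Fin d → S) {i : T → Fin d}
    (hi : Measurable i) {x : ℕ → T → S} (N : ℕ) (hx : ∀ l ≤ N, Measurable (x l)) :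
    Measurable fun ω => decode Λ h (i ω) (fun l => x l ω) N := by
  induction N with
  | zero => exact hi
  | succ N ih =>
    exact (measurable_decodeStep Λ h).comp
      ((ih fun l hl => hx l (hl.trans N.le_succ)).prodMk (hx _ le_rfl))

theorem decodeStep_eq {d : ℕ} {S : Type*} {Λ : Matrix (Fin d) (Fin d) ℝ} {h : Fin d → S}
    (hΛ : ∀ i, Λ i i ≤ 0) (h1 : ∀ i j : Fin d, i ≠ j → 0 < Λ i j → h i ≠ h j)
    (h2 : ∀ i j k : Fin d, i ≠ j → i ≠ k → j ≠ k → 0 < Λ i j → 0 < Λ i k → h j ≠ h k)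
    {i j : Fin d} (hij : i = j ∨ 0 < Λ i j) : decodeStep Λ h i (h j) = j := by
  have hne : ∀ {j}, 0 < Λ i j → i ≠ j := by
    rintro j hj rfl
    exact absurd hj (hΛ i).not_gt
  rcases eq_or_ne i j with rfl | hd
  · simp [decodeStep]
  · have hpos := hij.resolve_left hd
    have hx : h j ≠ h i ∧ ∃ k, 0 < Λ i k ∧ h k = h j := ⟨(h1 i j hd hpos).symm, j, hpos, rfl⟩
    rw [decodeStep, dif_pos hx]
    by_contra hk
    exact h2 i _ j (hne hx.2.choose_spec.1) hd hk hx.2.choose_spec.1 hpos hx.2.choose_spec.2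

theorem decode_eq {d : ℕ} {S : Type*} {Λ : Matrix (Fin d) (Fin d) ℝ} {h : Fin d → S}
    (hΛ : ∀ i, Λ i i ≤ 0) (h1 : ∀ i j : Fin d, i ≠ j → 0 < Λ i j → h i ≠ h j)
    (h2 : ∀ i j k : Fin d, i ≠ j → i ≠ k → j ≠ k → 0 < Λ i j → 0 < Λ i k → h j ≠ h k)
    {y : ℕ → Fin d} {N : ℕ} (hy : ∀ l < N, y l = y (l + 1) ∨ 0 < Λ (y l) (y (l + 1))) :
    decode Λ h (y 0) (fun l => h (y l)) N = y N := by
  induction N with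
  | zero => rfl
  | succ N ih =>
    rw [decode, ih fun l hl => hy l (hl.trans N.lt_succ_self)]
    exact decodeStep_eq hΛ h1 h2 (hy N N.lt_succ_self)

theorem IsIntensityMatrix.diag_nonpos {d : ℕ} {Λ : Matrix (Fin d) (Fin d) ℝ}
    (hΛ : IsIntensityMatrix Λ) (i : Fin d) : Λ i i ≤ 0 := by
  have h := hΛ.row_sum i
  rw [← Finset.add_sum_erase _ _ (Finset.mem_univ i)] at h
  have : 0 ≤ ∑ j ∈ Finset.univ.erase i, Λ i j :=
    Finset.sum_nonneg fun j hj => hΛ.nonneg i j (Finset.ne_of_mem_erase hj).symm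
  linarith

section

variable {Ω : Type*} [MeasurableSpace Ω] {P : Measure Ω} [IsProbabilityMeasure P] {d : ℕ}
  {X : ℝ → Ω → Fin d} {Λ : Matrix (Fin d) (Fin d) ℝ} {π : Fin d → ℝ}

/-- A move between two states at distance at least two for the graph of positive intensities
takes two jumps at least, hence is unlikely over a short time. -/
theorem IsStationaryFiniteMarkov.exists_measureReal_bad_step_le
    (hX : IsStationaryFiniteMarkov P X Λ π) :
    ∃ K > 0, ∃ δ > 0, ∀ a b : ℝ, a ≤ b → b - a ≤ δ →
      P.real {ω | ¬(X a ω = X b ω ∨ 0 < Λ (X a ω) (X b ω))} ≤ K * (b - a) ^ 2 := by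
  obtain ⟨K, hK, δ, hδ, hb⟩ := exists_abs_exp_smul_apply_sub_le Λ
  -- There are at most `d * d` bad pairs of states; the summand `1` only makes the constant positive.
  refine ⟨(d * d + 1) * K, by positivity, δ, hδ, fun a b hab hd => ?_⟩
  classical
  set I : Finset (Fin d × Fin d) := {p | ¬(p.1 = p.2 ∨ 0 < Λ p.1 p.2)} with hI
  have hsub : {ω | ¬(X a ω = X b ω ∨ 0 < Λ (X a ω) (X b ω))}
      ⊆ ⋃ p ∈ I, X a ⁻¹' {p.1} ∩ X b ⁻¹' {p.2} := by
    intro ω hω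
    simp only [Set.mem_iUnion]
    exact ⟨(X a ω, X b ω), by simpa [hI] using hω, rfl, rfl⟩
  have hterm : ∀ p ∈ I, P.real (X a ⁻¹' {p.1} ∩ X b ⁻¹' {p.2}) ≤ K * (b - a) ^ 2 := by
    rintro ⟨i, j⟩ hp
    simp only [hI, Finset.mem_filter, Finset.mem_univ, true_and, not_or, not_lt] at hp
    have hz : Λ i j = 0 := le_antisymm hp.2 (hX.intensity.nonneg i j hp.1)
    have h1 := hb (b - a) (sub_nonneg.2 hab) hd i j
    rw [Matrix.one_apply_ne hp.1, hz] at h1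
    have h2 := le_of_abs_le h1
    rw [hX.measureReal_transition hab]
    have h3 := hX.exp_nonneg (sub_nonneg.2 hab) i j
    have h4 := mul_le_mul_of_nonneg_right (hX.stationary_le_one i) h3
    simp only at *
    linarith
  have hcard : (I.card : ℝ) ≤ d * d := by
    have := Finset.card_le_univ I
    simp only [Fintype.card_prod, Fintype.card_fin] at this
    exact_mod_cast this
  calc P.real {ω | ¬(X a ω = X b ω ∨ 0 < Λ (X a ω) (X b ω))}
      ≤ ∑ p ∈ I, P.real (X a ⁻¹' {p.1} ∩ X b ⁻¹' {p.2}) :=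
        (measureReal_mono hsub (measure_ne_top _ _)).trans (measureReal_biUnion_finset_le _ _)
    _ ≤ ∑ p ∈ I, K * (b - a) ^ 2 := Finset.sum_le_sum hterm
    _ = I.card * (K * (b - a) ^ 2) := by simp
    _ ≤ (d * d + 1) * (K * (b - a) ^ 2) := by gcongr; linarith
    _ = (d * d + 1) * K * (b - a) ^ 2 := by ring

/-- Almost surely, on all fine enough dyadic subdivisions of `[s, t]`, the signal only makes moves
that are possible with one jump. -/
theorem IsStationaryFiniteMarkov.ae_eventually_good_steps
    (hX : IsStationaryFiniteMarkov P X Λ π) {s t : ℝ} (hst : s ≤ t) :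
    ∀ᵐ ω ∂P, ∀ᶠ n in atTop, ∀ l < 2 ^ n,
      X (dyadicTime s t n l) ω = X (dyadicTime s t n (l + 1)) ω ∨
        0 < Λ (X (dyadicTime s t n l) ω) (X (dyadicTime s t n (l + 1)) ω) := by
  obtain ⟨K, hK, δ, hδ, hb⟩ := hX.exists_measureReal_bad_step_le
  set bad : ℕ → Set Ω := fun n => {ω | ¬∀ l < 2 ^ n,
      X (dyadicTime s t n l) ω = X (dyadicTime s t n (l + 1)) ω ∨
        0 < Λ (X (dyadicTime s t n l) ω) (X (dyadicTime s t n (l + 1)) ω)} with hbad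
  have hmesh : ∀ᶠ n : ℕ in atTop, (t - s) / 2 ^ n ≤ δ := by
    have h1 : Tendsto (fun n : ℕ => (t - s) / 2 ^ n) atTop (𝓝 0) :=
      tendsto_const_nhds.div_atTop (tendsto_pow_atTop_atTop_of_one_lt one_lt_two)
    exact h1.eventually (eventually_le_nhds hδ)
  have hle : ∀ n : ℕ, (t - s) / 2 ^ n ≤ δ → P.real (bad n) ≤ K * (t - s) ^ 2 * (1 / 2) ^ n := by
    intro n hn
    have hstep : ∀ l, dyadicTime s t n (l + 1) - dyadicTime s t n l = (t - s) / 2 ^ n := by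
      intro l; simp only [dyadicTime]; push_cast; ring
    have h0 : 0 ≤ (t - s) / 2 ^ n := div_nonneg (sub_nonneg.2 hst) (by positivity)
    calc P.real (bad n)
        ≤ P.real (⋃ l ∈ Finset.range (2 ^ n),
          {ω | ¬(X (dyadicTime s t n l) ω = X (dyadicTime s t n (l + 1)) ω ∨
            0 < Λ (X (dyadicTime s t n l) ω) (X (dyadicTime s t n (l + 1)) ω))}) := by
          refine measureReal_mono (fun ω hω => ?_) (measure_ne_top _ _)
          simp only [hbad, Set.mem_ofPred_eq] at hω
          push Not at hω
          obtain ⟨l, hl, hω⟩ := hω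
          simp only [Set.mem_iUnion, Finset.mem_range]
          exact ⟨l, hl, by simpa using hω⟩
      _ ≤ ∑ l ∈ Finset.range (2 ^ n), K * ((t - s) / 2 ^ n) ^ 2 := by
          refine (measureReal_biUnion_finset_le _ _).trans (Finset.sum_le_sum fun l _ => ?_)
          rw [← hstep l]
          exact hb _ _ (by linarith [hstep l]) (by rw [hstep l]; exact hn)
      _ = K * (t - s) ^ 2 * (1 / 2) ^ n := by
          simp only [Finset.sum_const, Finset.card_range, nsmul_eq_mul]
          push_cast
          rw [one_div, inv_pow]
          field_simp
  obtain ⟨n₀, hn₀⟩ := eventually_atTop.1 hmesh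
  have hsum : ∑' n, P (bad (n + n₀)) ≠ ⊤ := by
    have hsm : Summable fun n : ℕ => K * (t - s) ^ 2 * (1 / 2) ^ (n + n₀) :=
      (summable_nat_add_iff n₀).2 (summable_geometric_two.mul_left _)
    refine ne_top_of_le_ne_top hsm.tsum_ofReal_ne_top (ENNReal.tsum_le_tsum fun n => ?_)
    rw [← ofReal_measureReal]
    exact ENNReal.ofReal_le_ofReal (hle _ (hn₀ _ (Nat.le_add_left n₀ n)))
  filter_upwards [ae_eventually_notMem hsum] with ω hω
  obtain ⟨n₁, hn₁⟩ := eventually_atTop.1 hω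
  filter_upwards [eventually_ge_atTop (n₁ + n₀)] with n hn
  have h1 := hn₁ (n - n₀) (by omega)
  rw [Nat.sub_add_cancel (by omega : n₀ ≤ n)] at h1
  exact not_not.1 h1

/-- If the signal can be followed jump by jump, then the model is invertible. -/
theorem IsStationaryFiniteMarkov.isInvertible (hX : IsStationaryFiniteMarkov P X Λ π)
    {S : Type*} [MeasurableSpace S] [MeasurableSingletonClass S] {h : Fin d → S}
    (h1 : ∀ i j : Fin d, i ≠ j → 0 < Λ i j → h i ≠ h j)
    (h2 : ∀ i j k : Fin d, i ≠ j → i ≠ k → j ≠ k → 0 < Λ i j → 0 < Λ i k → h j ≠ h k) :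
    IsInvertible P X h := by
  intro s t hst
  have : NeZero d := ⟨by
    rintro rfl
    have : Nonempty Ω := nonempty_of_isProbabilityMeasure P
    exact (X 0 (Classical.arbitrary Ω)).elim0⟩
  refine ⟨fun ω => limsup (fun n => decode Λ h (X s ω)
    (fun l => h (X (dyadicTime s t n l) ω)) (2 ^ n)) atTop, ?_, ?_⟩
  · refine Measurable.limsup fun n => ?_
    refine measurable_decode Λ h ?_ _ fun l hl => ?_
    · exact (comap_measurable (X s)).mono le_sup_left le_rfl
    · refine (comap_measurable fun ω => h (X (dyadicTime s t n l) ω)).mono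
        (le_trans ?_ le_sup_right) le_rfl
      exact comap_le_pathSigma (fun r ω => h (X r ω)) (dyadicTime_mem_Icc hst hl)
  · filter_upwards [hX.ae_eventually_good_steps hst] with ω hω
    refine (Tendsto.limsup_eq (tendsto_nhds_of_eventually_eq ?_)).symm
    filter_upwards [hω] with n hn
    have := decode_eq hX.intensity.diag_nonpos h1 h2
      (y := fun l => X (dyadicTime s t n l) ω) hn
    simpa only [dyadicTime_zero, dyadicTime_two_pow] using this

end

/-! ### Reduction to observations at dyadic times -/

/-- The sigma-field generated by `X s` and by the observations at the dyadic times of level `n`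
of `[s, t]`. -/
abbrev dyadicObs {Ω E S : Type*} [mE : MeasurableSpace E] [MeasurableSpace S]
    (X : ℝ → Ω → E) (h : E → S) (s t : ℝ) (n : ℕ) : MeasurableSpace Ω :=
  mE.comap (X s) ⊔ pathSigma (fun r ω => h (X r ω)) (dyadicTime s t n '' Set.Iic (2 ^ n))

theorem dyadicObs_mono {Ω E S : Type*} [MeasurableSpace E] [MeasurableSpace S]
    (X : ℝ → Ω → E) (h : E → S) (s t : ℝ) : Monotone (dyadicObs X h s t) := by
  refine monotone_nat_of_le_succ fun n => sup_le_sup_left (pathSigma_mono _ ?_) _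
  rintro _ ⟨l, hl, rfl⟩
  exact ⟨2 * l, by simp only [Set.mem_Iic] at *; omega, dyadicTime_succ_two_mul s t n l⟩

theorem dyadicObs_le {Ω E S : Type*} [mΩ : MeasurableSpace Ω] [MeasurableSpace E]
    [MeasurableSpace S] {X : ℝ → Ω → E} {h : E → S} (hX : ∀ r, Measurable (X r))
    (hh : Measurable h) (s t : ℝ) (n : ℕ) : dyadicObs X h s t n ≤ mΩ :=
  sup_le (hX s).comap_le (pathSigma_le (fun r => hh.comp (hX r)) _)

/-- Dyadic times approximate every `r ∈ [s, t]` from the right. -/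
theorem exists_dyadicTime_tendsto {s t r : ℝ} (hst : s < t) (hr : r ∈ Set.Icc s t) :
    ∃ l : ℕ → ℕ, (∀ n, l n ≤ 2 ^ n) ∧
      Tendsto (fun n => dyadicTime s t n (l n)) atTop (𝓝[≥] r) := by
  have hts : 0 < t - s := sub_pos.2 hst
  set x : ℝ := (r - s) / (t - s) with hx
  have hx0 : 0 ≤ x := div_nonneg (sub_nonneg.2 hr.1) hts.le
  have hx1 : x ≤ 1 := (div_le_one hts).2 (by linarith [hr.2])
  have hxr : x * (t - s) = r - s := div_mul_cancel₀ _ hts.ne'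
  have hp : ∀ n : ℕ, (0 : ℝ) < 2 ^ n := fun n => by positivity
  have heq : ∀ n l : ℕ, dyadicTime s t n l = r + (l - x * 2 ^ n) * ((t - s) / 2 ^ n) := by
    intro n l
    have := (hp n).ne'
    rw [sub_mul, mul_assoc, mul_div_cancel₀ _ this, hxr, dyadicTime]
    ring
  refine ⟨fun n => ⌈x * 2 ^ n⌉₊, fun n => ?_, ?_⟩
  · refine Nat.ceil_le.2 ?_
    push_cast
    nlinarith [hp n]
  have hge : ∀ n : ℕ, r ≤ dyadicTime s t n ⌈x * 2 ^ n⌉₊ := fun n => by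
    rw [heq]
    have := mul_nonneg (sub_nonneg.2 (Nat.le_ceil (x * 2 ^ n))) (div_pos hts (hp n)).le
    linarith
  refine tendsto_nhdsWithin_iff.2 ⟨?_, Eventually.of_forall hge⟩
  have hlim : Tendsto (fun n : ℕ => r + (t - s) / 2 ^ n) atTop (𝓝 r) := by
    have h1 : Tendsto (fun n : ℕ => (t - s) / 2 ^ n) atTop (𝓝 0) :=
      tendsto_const_nhds.div_atTop (tendsto_pow_atTop_atTop_of_one_lt one_lt_two)
    simpa using h1.const_add r
  refine tendsto_of_tendsto_of_tendsto_of_le_of_le tendsto_const_nhds hlim hge fun n => ?_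
  have h1 : (⌈x * 2 ^ n⌉₊ : ℝ) - x * 2 ^ n ≤ 1 := by
    linarith [Nat.ceil_lt_add_one (mul_nonneg hx0 (hp n).le)]
  have h2 := mul_le_mul_of_nonneg_right h1 (div_pos hts (hp n)).le
  simp only
  rw [heq]
  linarith

/-- By right continuity, the observations at dyadic times generate all observations. -/
theorem comap_sup_pathSigma_le_iSup_dyadicObs {Ω E S : Type*} [MeasurableSpace E]
    [TopologicalSpace E] [MeasurableSpace S] [TopologicalSpace S]
    [TopologicalSpace.PseudoMetrizableSpace S] [BorelSpace S] {X : ℝ → Ω → E} {h : E → S}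
    (hX : ∀ ω, IsCadlag fun r => X r ω) (hh : Continuous h) {s t : ℝ} (hst : s < t) :
    MeasurableSpace.comap (X s) inferInstance ⊔ pathSigma (fun r ω => h (X r ω)) (Set.Icc s t)
      ≤ ⨆ n, dyadicObs X h s t n := by
  refine sup_le (le_trans le_sup_left (le_iSup (dyadicObs X h s t) 0)) (iSup₂_le fun r hr => ?_)
  obtain ⟨l, hl, hlim⟩ := exists_dyadicTime_tendsto hst hr
  rw [← measurable_iff_comap_le]
  let m : MeasurableSpace Ω := ⨆ n, dyadicObs X h s t n
  refine measurable_of_tendsto_metrizable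
    (f := fun n ω => h (X (dyadicTime s t n (l n)) ω)) (fun n => ?_) ?_
  · refine (comap_measurable fun ω => h (X (dyadicTime s t n (l n)) ω)).mono ?_ le_rfl
    refine le_trans ?_ (le_trans le_sup_right (le_iSup (dyadicObs X h s t) n))
    exact comap_le_pathSigma (fun r ω => h (X r ω)) ⟨l n, hl n, rfl⟩
  · exact tendsto_pi_nhds.2 fun ω =>
      (hh.tendsto _).comp ((hX ω r).1.tendsto.comp hlim)

/-- An event of a sigma-field does not separate two points at which the generators agree. -/
theorem mem_iff_of_measurableSet_sup_pathSigma {Ω E S : Type*} [mE : MeasurableSpace E]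
    [MeasurableSpace S] {f : Ω → E} {Z : ℝ → Ω → S} {I : Set ℝ} {G : Set Ω}
    (hG : MeasurableSet[mE.comap f ⊔ pathSigma Z I] G) {ω ω' : Ω} (hf : f ω = f ω')
    (hZ : ∀ r ∈ I, Z r ω = Z r ω') : ω ∈ G ↔ ω' ∈ G := by
  have hle : mE.comap f ⊔ pathSigma Z I
      ≤ MeasurableSpace.comap (fun ω => (f ω, fun r : I => Z r ω)) ⊤ := by
    refine sup_le ?_ (iSup₂_le fun r hr => ?_)
    · rintro _ ⟨A, -, rfl⟩
      exact ⟨Prod.fst ⁻¹' A, trivial, rfl⟩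
    · rintro _ ⟨A, -, rfl⟩
      exact ⟨{p | p.2 ⟨r, hr⟩ ∈ A}, trivial, rfl⟩
  obtain ⟨B, -, rfl⟩ := hle _ hG
  have : (f ω, fun r : I => Z r ω) = (f ω', fun r : I => Z r ω') :=
    Prod.ext hf (funext fun r => hZ r r.2)
  simp only [Set.mem_preimage, this]

/-- A domination `P (G ∩ B) ≤ C * P (G ∩ B')` passes from the events of an increasing sequence of
sigma-fields to those of the sigma-field that they generate. -/
theorem measureReal_inter_le_of_measurableSet_iSup {Ω : Type*} [m0 : MeasurableSpace Ω]
    {P : Measure Ω} [IsFiniteMeasure P] {m : ℕ → MeasurableSpace Ω} (hm : Monotone m)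
    (hle : ∀ n, m n ≤ m0) {B B' : Set Ω} {C : ℝ} (hC : 0 ≤ C)
    (hB : ∀ n G, MeasurableSet[m n] G → P.real (G ∩ B) ≤ C * P.real (G ∩ B'))
    {G : Set Ω} (hG : MeasurableSet[⨆ n, m n] G) :
    P.real (G ∩ B) ≤ C * P.real (G ∩ B') := by
  have halg : IsSetAlgebra (⋃ n, {A : Set Ω | MeasurableSet[m n] A}) := by
    refine ⟨?_, ?_, ?_⟩
    · exact Set.mem_iUnion.2 ⟨0, @MeasurableSet.empty _ (m 0)⟩
    · intro A hA
      obtain ⟨n, hn⟩ := Set.mem_iUnion.1 hA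
      exact Set.mem_iUnion.2 ⟨n, @MeasurableSet.compl _ _ (m n) hn⟩
    · intro A A' hA hA'
      obtain ⟨n, hn⟩ := Set.mem_iUnion.1 hA
      obtain ⟨n', hn'⟩ := Set.mem_iUnion.1 hA'
      exact Set.mem_iUnion.2 ⟨max n n', @MeasurableSet.union _ (m (max n n')) _ _
        (hm (le_max_left _ _) _ hn) (hm (le_max_right _ _) _ hn')⟩
  have hsup : (⨆ n, m n) ≤ m0 := iSup_le hle
  have hdense := @Measure.MeasureDense.of_generateFrom_isSetAlgebra_finite Ω (⨆ n, m n)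
    (P.trim hsup) _ _ halg (MeasurableSpace.generateFrom_iUnion_measurableSet m).symm
  refine le_of_forall_pos_le_add fun ε hε => ?_
  obtain ⟨A, hA, hlt⟩ := @Measure.MeasureDense.approx Ω (⨆ n, m n) _ _ hdense G hG
    (@measure_ne_top _ (⨆ n, m n) _ _ _) (ε / (1 + C)) (by positivity)
  obtain ⟨n, hn⟩ := Set.mem_iUnion.1 hA
  have hAm : MeasurableSet[⨆ n, m n] A := le_iSup m n _ hn
  rw [trim_measurableSet_eq hsup (@MeasurableSet.symmDiff _ (⨆ n, m n) _ _ hG hAm)] at hlt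
  have hd : P.real (symmDiff G A) ≤ ε / (1 + C) :=
    ENNReal.toReal_le_of_le_ofReal (by positivity) hlt.le
  have key : ∀ U V D : Set Ω, P.real (U ∩ D) ≤ P.real (V ∩ D) + P.real (symmDiff U V) := by
    intro U V D
    refine (measureReal_mono (fun ω hω => ?_) (measure_ne_top _ _)).trans (measureReal_union_le _ _)
    by_cases hV : ω ∈ V
    · exact Or.inl ⟨hV, hω.2⟩
    · exact Or.inr (Or.inl ⟨hω.1, hV⟩)
  have h1 := key G A B
  have h2 := key A G B'
  rw [symmDiff_comm A G] at h2
  have h3 := hB n A hn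
  have h4 : C * P.real (A ∩ B') ≤ C * (P.real (G ∩ B') + ε / (1 + C)) := by gcongr; linarith
  have h5 : ε / (1 + C) + C * (ε / (1 + C)) = ε := by field_simp
  linarith

/-- The model is not invertible if there are two events `⋂ n, B n` and `⋂ n, B' n` on which `X t`
takes different values, and such that, up to a constant, the first is less likely than the second,
conditionally on the observations. -/
theorem not_isInvertible_of_le {Ω E S : Type*} [MeasurableSpace Ω] {P : Measure Ω}
    [IsProbabilityMeasure P] [MeasurableSpace E] [MeasurableSingletonClass E]
    [TopologicalSpace E] [MeasurableSpace S] [TopologicalSpace S]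
    [TopologicalSpace.PseudoMetrizableSpace S] [BorelSpace S] {X : ℝ → Ω → E} {h : E → S}
    (hmeas : ∀ r, Measurable (X r)) (hX : ∀ ω, IsCadlag fun r => X r ω)
    (hh : Continuous h) (hhm : Measurable h) {s t : ℝ} (hst : s < t) {B B' : ℕ → Set Ω}
    (hBm : ∀ n, MeasurableSet (B n)) (hBm' : ∀ n, MeasurableSet (B' n))
    (hBa : Antitone B) (hBa' : Antitone B') {C c : ℝ} (hC : 0 ≤ C) (hc : 0 < c)
    (hle : ∀ n G, MeasurableSet[dyadicObs X h s t n] G →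
      P.real (G ∩ B n) ≤ C * P.real (G ∩ B' n))
    (hcB : ∀ n, c ≤ P.real (B n)) {j : E} (hj : ∀ ω ∈ B 0, X t ω = j)
    (hj' : ∀ ω ∈ B' 0, X t ω ≠ j) : ¬IsInvertible P X h := by
  intro hinv
  obtain ⟨Z, hZ, hXZ⟩ := hinv s t hst.le
  have hlim : ∀ (F : ℕ → Set Ω) (G : Set Ω), (∀ n, MeasurableSet (F n)) → Antitone F →
      MeasurableSet G → Tendsto (fun n => P.real (G ∩ F n)) atTop (𝓝 (P.real (G ∩ ⋂ n, F n))) := by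
    intro F G hF hFa hG
    have h1 := tendsto_measure_iInter_atTop (μ := P) (s := fun n => G ∩ F n)
      (fun n => (hG.inter (hF n)).nullMeasurableSet)
      (fun _ _ hab => Set.inter_subset_inter_right _ (hFa hab)) ⟨0, measure_ne_top _ _⟩
    rw [← Set.inter_iInter] at h1
    exact (ENNReal.tendsto_toReal (measure_ne_top _ _)).comp h1
  have hobs := dyadicObs_le hmeas hhm s t
  have hdom : ∀ n G, MeasurableSet[dyadicObs X h s t n] G →
      P.real (G ∩ ⋂ n, B n) ≤ C * P.real (G ∩ ⋂ n, B' n) := by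
    intro n G hG
    have hG0 := hobs n _ hG
    refine le_of_tendsto_of_tendsto (hlim B G hBm hBa hG0)
      ((hlim B' G hBm' hBa' hG0).const_mul C) ?_
    filter_upwards [eventually_ge_atTop n] with N hN
    exact hle N G (dyadicObs_mono X h s t hN _ hG)
  have hG : MeasurableSet[⨆ n, dyadicObs X h s t n] (Z ⁻¹' {j}) :=
    comap_sup_pathSigma_le_iSup_dyadicObs hX hh hst _ (hZ (MeasurableSet.singleton j))
  have hfin := measureReal_inter_le_of_measurableSet_iSup (dyadicObs_mono X h s t) hobs hC hdom hG
  have h0 : P.real (Z ⁻¹' {j} ∩ ⋂ n, B' n) = 0 := by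
    have : P (Z ⁻¹' {j} ∩ ⋂ n, B' n) = 0 := by
      refine measure_mono_null (fun ω hω => ?_) (ae_iff.1 hXZ)
      intro heq
      exact hj' ω (Set.mem_iInter.1 hω.2 0) (heq.trans hω.1)
    simp [measureReal_def, this]
  have h1 : P.real (Z ⁻¹' {j} ∩ ⋂ n, B n) = P.real (⋂ n, B n) := by
    refine measureReal_congr ?_
    filter_upwards [hXZ] with ω hω
    refine propext ⟨fun hω' => hω'.2, fun hω' => ⟨?_, hω'⟩⟩
    exact hω.symm.trans (hj ω (Set.mem_iInter.1 hω' 0))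
  have h2 : c ≤ P.real (⋂ n, B n) := by
    have := hlim B Set.univ hBm hBa MeasurableSet.univ
    simp only [Set.univ_inter] at this
    exact ge_of_tendsto' this hcB
  rw [h0, h1, mul_zero] at hfin
  linarith

/-! ### Paths with a single jump -/

/-- The sequence of states that leaves `i` for `j` at the index `m`. -/
def jumpPath {d : ℕ} (i j : Fin d) (m : ℕ) : ℕ → Fin d := fun l => if l < m then i else j

/-- The event that, at the dyadic times of level `n` of `[s, t]`, the signal starts from `i`,
moves to `j`, and stays there. -/
def singleJump {Ω : Type*} {d : ℕ} (X : ℝ → Ω → Fin d) (s t : ℝ) (i j : Fin d) (n : ℕ) : Set Ω :=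
  ⋃ m ∈ Finset.Icc 1 (2 ^ n), gridPath X s ((t - s) / 2 ^ n) (2 ^ n) (jumpPath i j m)

/-- The event that the signal is in the state `i` at all dyadic times of level `n` of `[s, t]`. -/
def noJump {Ω : Type*} {d : ℕ} (X : ℝ → Ω → Fin d) (s t : ℝ) (i : Fin d) (n : ℕ) : Set Ω :=
  gridPath X s ((t - s) / 2 ^ n) (2 ^ n) fun _ => i

theorem mem_gridPath_dyadic {Ω : Type*} {d : ℕ} {X : ℝ → Ω → Fin d} {s t : ℝ} {n : ℕ}
    {y : ℕ → Fin d} {ω : Ω} : ω ∈ gridPath X s ((t - s) / 2 ^ n) (2 ^ n) y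
      ↔ ∀ l ≤ 2 ^ n, X (dyadicTime s t n l) ω = y l := Iff.rfl

theorem gridPath_succ_subset {Ω : Type*} {d : ℕ} (X : ℝ → Ω → Fin d) (s t : ℝ) (n : ℕ)
    (y : ℕ → Fin d) : gridPath X s ((t - s) / 2 ^ (n + 1)) (2 ^ (n + 1)) y
      ⊆ gridPath X s ((t - s) / 2 ^ n) (2 ^ n) fun l => y (2 * l) := by
  intro ω hω
  rw [mem_gridPath_dyadic] at *
  intro l hl
  rw [← dyadicTime_succ_two_mul]
  exact hω _ (by omega)

theorem antitone_noJump {Ω : Type*} {d : ℕ} (X : ℝ → Ω → Fin d) (s t : ℝ) (i : Fin d) :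
    Antitone (noJump X s t i) :=
  antitone_nat_of_succ_le fun n => gridPath_succ_subset X s t n _

theorem antitone_singleJump {Ω : Type*} {d : ℕ} (X : ℝ → Ω → Fin d) (s t : ℝ) (i j : Fin d) :
    Antitone (singleJump X s t i j) := by
  refine antitone_nat_of_succ_le fun n ω hω => ?_
  simp only [singleJump, Set.mem_iUnion, Finset.mem_Icc] at *
  obtain ⟨m, hm, hω⟩ := hω
  -- On the coarser grid the jump is seen at the first even index that is at least `m`.
  refine ⟨(m + 1) / 2, by omega, ?_⟩
  have : (fun l => jumpPath i j m (2 * l)) = jumpPath i j ((m + 1) / 2) := by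
    funext l
    have : 2 * l < m ↔ l < (m + 1) / 2 := by omega
    simp only [jumpPath, this]
  exact this ▸ gridPath_succ_subset X s t n _ hω

theorem apply_eq_of_mem_noJump {Ω : Type*} {d : ℕ} {X : ℝ → Ω → Fin d} {s t : ℝ} {i : Fin d}
    {n : ℕ} {ω : Ω} (hω : ω ∈ noJump X s t i n) : X t ω = i := by
  have := mem_gridPath_dyadic.1 hω (2 ^ n) le_rfl
  rwa [dyadicTime_two_pow] at this

theorem apply_eq_of_mem_singleJump {Ω : Type*} {d : ℕ} {X : ℝ → Ω → Fin d} {s t : ℝ}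
    {i j : Fin d} {n : ℕ} {ω : Ω} (hω : ω ∈ singleJump X s t i j n) : X t ω = j := by
  simp only [singleJump, Set.mem_iUnion, Finset.mem_Icc] at hω
  obtain ⟨m, hm, hω⟩ := hω
  have := mem_gridPath_dyadic.1 hω (2 ^ n) le_rfl
  rwa [dyadicTime_two_pow, jumpPath, if_neg (by omega)] at this

theorem pairwiseDisjoint_gridPath_jumpPath {Ω : Type*} {d : ℕ} (X : ℝ → Ω → Fin d) (s u : ℝ)
    {i j : Fin d} (hij : i ≠ j) (N : ℕ) :
    (Finset.Icc 1 N : Set ℕ).PairwiseDisjoint fun m => gridPath X s u N (jumpPath i j m) := by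
  have key : ∀ m m' : ℕ, m < m' → m' ≤ N →
      Disjoint (gridPath X s u N (jumpPath i j m)) (gridPath X s u N (jumpPath i j m')) := by
    intro m m' hlt hle
    refine Set.disjoint_left.2 fun ω h1 h2 => hij ?_
    have e1 := h1 m (by omega)
    have e2 := h2 m (by omega)
    rw [e1, jumpPath, jumpPath, if_neg (lt_irrefl m), if_pos hlt] at e2
    exact e2.symm
  intro m hm m' hm' hne
  rw [Finset.mem_coe, Finset.mem_Icc] at hm hm'
  rcases hne.lt_or_gt with hlt | hlt
  · exact key m m' hlt hm'.2
  · exact (key m' m hlt hm.2).symm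

theorem IsStationaryFiniteMarkov.measurableSet_gridPath_dyadic {Ω : Type*}
    [MeasurableSpace Ω] {P : Measure Ω} {d : ℕ} {X : ℝ → Ω → Fin d}
    {Λ : Matrix (Fin d) (Fin d) ℝ} {π : Fin d → ℝ}
    (hX : IsStationaryFiniteMarkov P X Λ π) {s t : ℝ} (hst : s ≤ t) (n : ℕ) (y : ℕ → Fin d) :
    MeasurableSet (gridPath X s ((t - s) / 2 ^ n) (2 ^ n) y) :=
  pathSigma_le hX.measurable _ _
    (measurableSet_gridPath X s (div_nonneg (sub_nonneg.2 hst) (by positivity)) _ y)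

theorem IsStationaryFiniteMarkov.measurableSet_singleJump {Ω : Type*}
    [MeasurableSpace Ω] {P : Measure Ω} {d : ℕ} {X : ℝ → Ω → Fin d}
    {Λ : Matrix (Fin d) (Fin d) ℝ} {π : Fin d → ℝ}
    (hX : IsStationaryFiniteMarkov P X Λ π) {s t : ℝ} (hst : s ≤ t) (i j : Fin d) (n : ℕ) :
    MeasurableSet (singleJump X s t i j n) :=
  Finset.measurableSet_biUnion _ fun _ _ => hX.measurableSet_gridPath_dyadic hst n _

section Markov

variable {Ω : Type*} [MeasurableSpace Ω] {P : Measure Ω} [IsProbabilityMeasure P] {d : ℕ}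
  {X : ℝ → Ω → Fin d} {Λ : Matrix (Fin d) (Fin d) ℝ} {π : Fin d → ℝ}

theorem IsStationaryFiniteMarkov.measureReal_gridPath_jumpPath
    (hX : IsStationaryFiniteMarkov P X Λ π) (s : ℝ) {u : ℝ} (hu : 0 ≤ u) (i j : Fin d) (a b : ℕ) :
    P.real (gridPath X s u (a + 1 + b) (jumpPath i j (a + 1)))
      = π i * (NormedSpace.exp (u • Λ) i i ^ a * NormedSpace.exp (u • Λ) i j
          * NormedSpace.exp (u • Λ) j j ^ b) := by
  rw [hX.measureReal_gridPath s hu, Finset.prod_range_add, Finset.prod_range_succ]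
  have h1 : ∀ l ∈ Finset.range a, NormedSpace.exp (u • Λ) (jumpPath i j (a + 1) l)
      (jumpPath i j (a + 1) (l + 1)) = NormedSpace.exp (u • Λ) i i := by
    intro l hl
    rw [Finset.mem_range] at hl
    rw [jumpPath, jumpPath, if_pos (by omega), if_pos (by omega)]
  have h2 : ∀ l ∈ Finset.range b, NormedSpace.exp (u • Λ) (jumpPath i j (a + 1) (a + 1 + l))
      (jumpPath i j (a + 1) (a + 1 + l + 1)) = NormedSpace.exp (u • Λ) j j := by
    intro l _
    rw [jumpPath, jumpPath, if_neg (by omega), if_neg (by omega)]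
  rw [Finset.prod_congr rfl h1, Finset.prod_congr rfl h2]
  simp [jumpPath]

/-- Over a short time span, divided into any number of steps, the signal is likely not to move. -/
theorem exists_half_le_exp_smul_diag_pow {d : ℕ} (Λ : Matrix (Fin d) (Fin d) ℝ) :
    ∃ δ > 0, ∀ u : ℝ, 0 ≤ u → ∀ m : ℕ, m * u ≤ δ → ∀ i,
      1 / 2 ≤ NormedSpace.exp (u • Λ) i i ^ m := by
  obtain ⟨K, hK, δ, hδ, hb⟩ := exists_abs_exp_smul_apply_sub_le Λ
  set a : ℝ := K * δ + ∑ i, |Λ i i| with ha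
  have hsum : 0 ≤ ∑ i, |Λ i i| := Finset.sum_nonneg fun i _ => abs_nonneg _
  have ha0 : 0 < a := by positivity
  refine ⟨min δ (1 / (2 * a)), by positivity, fun u hu m hm i => ?_⟩
  rcases Nat.eq_zero_or_pos m with rfl | hm0
  · norm_num
  have hm1 : (1 : ℝ) ≤ m := by exact_mod_cast hm0
  have hum : u ≤ m * u := le_mul_of_one_le_left hu hm1
  have huδ : u ≤ δ := hum.trans (hm.trans (min_le_left _ _))
  have hma : m * u * a ≤ 1 / 2 := by
    have := mul_le_mul_of_nonneg_right (hm.trans (min_le_right _ _)) ha0.le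
    have h2 : 1 / (2 * a) * a = 1 / 2 := by field_simp
    linarith
  have hua : u * a ≤ 1 / 2 := (mul_le_mul_of_nonneg_right hum ha0.le).trans hma
  have hii : 1 + -(u * a) ≤ NormedSpace.exp (u • Λ) i i := by
    have h1 := neg_le_of_abs_le (hb u hu huδ i i)
    rw [Matrix.one_apply_eq] at h1
    have h2 : |Λ i i| ≤ ∑ i, |Λ i i| :=
      Finset.single_le_sum (f := fun i => |Λ i i|) (fun i _ => abs_nonneg _) (Finset.mem_univ i)
    have h3 := neg_abs_le (Λ i i)
    have h4 : u * (-∑ i, |Λ i i|) ≤ u * Λ i i := mul_le_mul_of_nonneg_left (by linarith) hu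
    have h5 : K * u ^ 2 ≤ u * (K * δ) := by
      have := mul_le_mul_of_nonneg_left huδ (mul_nonneg hK.le hu)
      nlinarith
    have h6 : u * a = u * (K * δ) + u * ∑ i, |Λ i i| := by rw [ha]; ring
    linarith
  calc (1 : ℝ) / 2 ≤ 1 + m * -(u * a) := by linarith
    _ ≤ (1 + -(u * a)) ^ m := one_add_mul_le_pow (by linarith) m
    _ ≤ NormedSpace.exp (u • Λ) i i ^ m := pow_le_pow_left₀ (by linarith) hii m

/-- Over a short time `u`, the probability of a transition of positive intensity is of order
`u`. -/
theorem exists_exp_smul_apply_mem_Icc {d : ℕ} {Λ : Matrix (Fin d) (Fin d) ℝ} {i j : Fin d}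
    (hij : i ≠ j) (hpos : 0 < Λ i j) :
    ∃ δ > 0, ∀ u : ℝ, 0 ≤ u → u ≤ δ →
      Λ i j / 2 * u ≤ NormedSpace.exp (u • Λ) i j ∧
        NormedSpace.exp (u • Λ) i j ≤ 2 * Λ i j * u := by
  obtain ⟨K, hK, δ, hδ, hb⟩ := exists_abs_exp_smul_apply_sub_le Λ
  refine ⟨min δ (Λ i j / (2 * K)), by positivity, fun u hu huδ => ?_⟩
  have h1 := hb u hu (huδ.trans (min_le_left _ _)) i j
  rw [Matrix.one_apply_ne hij, abs_le] at h1
  have h2 : K * u ≤ Λ i j / 2 := by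
    have := mul_le_mul_of_nonneg_left (huδ.trans (min_le_right _ _)) hK.le
    have h3 : K * (Λ i j / (2 * K)) = Λ i j / 2 := by field_simp
    linarith
  have h4 := mul_le_mul_of_nonneg_right h2 hu
  have h5 := mul_nonneg hpos.le hu
  constructor <;> nlinarith [h1.1, h1.2]

/-- Over a short time span, all grid paths with one jump from `i` to `j` have a probability of the
order of the mesh, uniformly in the mesh and in the time of the jump. -/
theorem IsStationaryFiniteMarkov.exists_measureReal_jumpPath_mem_Icc
    (hX : IsStationaryFiniteMarkov P X Λ π) {i j : Fin d} (hij : i ≠ j) (hpos : 0 < Λ i j) :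
    ∃ δ > 0, ∀ s u : ℝ, 0 ≤ u → ∀ N : ℕ, N * u ≤ δ → ∀ m ∈ Finset.Icc 1 N,
      π i * (Λ i j / 8 * u) ≤ P.real (gridPath X s u N (jumpPath i j m)) ∧
        P.real (gridPath X s u N (jumpPath i j m)) ≤ π i * (2 * Λ i j * u) := by
  obtain ⟨δ, hδ, hdiag⟩ := exists_half_le_exp_smul_diag_pow Λ
  obtain ⟨δ', hδ', hoff⟩ := exists_exp_smul_apply_mem_Icc hij hpos
  refine ⟨min δ δ', by positivity, fun s u hu N hN m hm => ?_⟩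
  rw [Finset.mem_Icc] at hm
  obtain ⟨a, rfl⟩ : ∃ a, m = a + 1 := ⟨m - 1, by omega⟩
  obtain ⟨b, rfl⟩ : ∃ b, N = a + 1 + b := ⟨N - (a + 1), by omega⟩
  rw [hX.measureReal_gridPath_jumpPath s hu]
  push_cast at hN
  have hau : 0 ≤ a * u := by positivity
  have hbu : 0 ≤ b * u := by positivity
  have hδ1 := hN.trans (min_le_left _ _)
  have hδ2 := hN.trans (min_le_right _ _)
  have hi := hdiag u hu a (by linarith) i
  have hj := hdiag u hu b (by linarith) j
  have hi1 := pow_le_one₀ (n := a) (hX.exp_nonneg hu i i) (hX.exp_le_one hu i i)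
  have hj1 := pow_le_one₀ (n := b) (hX.exp_nonneg hu j j) (hX.exp_le_one hu j j)
  obtain ⟨hl, hr⟩ := hoff u hu (by linarith)
  have hp := hX.exp_nonneg hu i j
  have hu' : 0 ≤ Λ i j / 2 * u := by positivity
  refine ⟨mul_le_mul_of_nonneg_left ?_ (hX.pos i).le, mul_le_mul_of_nonneg_left ?_ (hX.pos i).le⟩
  · calc Λ i j / 8 * u = 1 / 2 * (Λ i j / 2 * u) * (1 / 2) := by ring
      _ ≤ _ := by gcongr
  · refine le_trans ?_ hr
    refine (mul_le_of_le_one_right (by positivity) hj1).trans ?_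
    exact mul_le_of_le_one_left hp hi1

/-- The probability of a single jump does not vanish as the mesh tends to zero: there are `2 ^ n`
disjoint paths, each with a probability of order `2⁻ⁿ`. -/
theorem IsStationaryFiniteMarkov.exists_le_measureReal_singleJump
    (hX : IsStationaryFiniteMarkov P X Λ π) {i j : Fin d} (hij : i ≠ j) (hpos : 0 < Λ i j) :
    ∃ δ > 0, ∀ s t : ℝ, s < t → t - s ≤ δ →
      ∃ c > 0, ∀ n, c ≤ P.real (singleJump X s t i j n) := by
  obtain ⟨δ, hδ, hb⟩ := hX.exists_measureReal_jumpPath_mem_Icc hij hpos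
  refine ⟨δ, hδ, fun s t hst htδ => ⟨π i * (Λ i j / 8 * (t - s)), ?_, fun n => ?_⟩⟩
  · have := hX.pos i
    have := sub_pos.2 hst
    positivity
  · have hu : 0 ≤ (t - s) / 2 ^ n := div_nonneg (sub_nonneg.2 hst.le) (by positivity)
    have hN : ((2 ^ n : ℕ) : ℝ) * ((t - s) / 2 ^ n) = t - s := by push_cast; field_simp
    rw [singleJump, measureReal_biUnion_finset (pairwiseDisjoint_gridPath_jumpPath X s _ hij _)
      fun m _ => hX.measurableSet_gridPath_dyadic hst.le n _]
    calc π i * (Λ i j / 8 * (t - s))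
        = ∑ m ∈ Finset.Icc 1 (2 ^ n), π i * (Λ i j / 8 * ((t - s) / 2 ^ n)) := by
          rw [Finset.sum_const, Nat.card_Icc, nsmul_eq_mul, Nat.add_sub_cancel]
          nth_rw 1 [← hN]
          ring
      _ ≤ _ := Finset.sum_le_sum fun m hm => (hb s _ hu _ (hN.trans_le htδ) m hm).1

/-! ### Failure of invertibility -/

/-- An event of the observations either contains or misses a given grid path, and contains or
misses all grid paths with the same observations along with it. -/
theorem measureReal_inter_gridPath_le {S : Type*} [MeasurableSpace S] {h : Fin d → S}
    {s t : ℝ} {n : ℕ} {y y' : ℕ → Fin d} (h0 : y 0 = y' 0)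
    (hy : ∀ l ≤ 2 ^ n, h (y l) = h (y' l)) {C : ℝ} (hC : 0 ≤ C)
    (hpos : 0 < P.real (gridPath X s ((t - s) / 2 ^ n) (2 ^ n) y'))
    (hle : P.real (gridPath X s ((t - s) / 2 ^ n) (2 ^ n) y)
      ≤ C * P.real (gridPath X s ((t - s) / 2 ^ n) (2 ^ n) y'))
    {G : Set Ω} (hG : MeasurableSet[dyadicObs X h s t n] G) :
    P.real (G ∩ gridPath X s ((t - s) / 2 ^ n) (2 ^ n) y)
      ≤ C * P.real (G ∩ gridPath X s ((t - s) / 2 ^ n) (2 ^ n) y') := by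
  have key : ∀ z z' : ℕ → Fin d, z 0 = z' 0 → (∀ l ≤ 2 ^ n, h (z l) = h (z' l)) →
      ∀ ω ∈ gridPath X s ((t - s) / 2 ^ n) (2 ^ n) z,
      ∀ ω' ∈ gridPath X s ((t - s) / 2 ^ n) (2 ^ n) z', ω ∈ G ↔ ω' ∈ G := by
    intro z z' hz0 hz ω hω ω' hω'
    rw [mem_gridPath_dyadic] at hω hω'
    refine mem_iff_of_measurableSet_sup_pathSigma hG ?_ ?_
    · have e1 := hω 0 (Nat.zero_le _)
      have e2 := hω' 0 (Nat.zero_le _)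
      rw [dyadicTime_zero] at e1 e2
      rw [e1, e2, hz0]
    · rintro _ ⟨l, hl, rfl⟩
      rw [hω l hl, hω' l hl, hz l hl]
  obtain ⟨ω', hω'⟩ : (gridPath X s ((t - s) / 2 ^ n) (2 ^ n) y').Nonempty := by
    by_contra hne
    rw [Set.not_nonempty_iff_eq_empty.1 hne] at hpos
    simp at hpos
  by_cases hmem : ω' ∈ G
  · have hsub : gridPath X s ((t - s) / 2 ^ n) (2 ^ n) y' ⊆ G := fun ω hω =>
      (key y' y' rfl (fun _ _ => rfl) ω hω ω' hω').2 hmem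
    rw [Set.inter_eq_right.2 hsub]
    exact (measureReal_mono Set.inter_subset_right (measure_ne_top _ _)).trans hle
  · have hempty : G ∩ gridPath X s ((t - s) / 2 ^ n) (2 ^ n) y = ∅ :=
      Set.eq_empty_iff_forall_notMem.2 fun ω hω => hmem ((key y y' h0 hy ω hω.2 ω' hω').1 hω.1)
    rw [hempty, measureReal_empty]
    exact mul_nonneg hC measureReal_nonneg

variable {S : Type*} [MeasurableSpace S] [TopologicalSpace S]
  [TopologicalSpace.PseudoMetrizableSpace S] [BorelSpace S] {h : Fin d → S}

/-- A jump that does not change the observation cannot be told from no jump at all. -/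
theorem IsStationaryFiniteMarkov.not_isInvertible_of_invisible_jump
    (hX : IsStationaryFiniteMarkov P X Λ π) {i j : Fin d} (hij : i ≠ j) (hpos : 0 < Λ i j)
    (hh : h i = h j) : ¬IsInvertible P X h := by
  obtain ⟨δ, hδ, hB⟩ := hX.exists_le_measureReal_singleJump hij hpos
  obtain ⟨δ', hδ', hb⟩ := hX.exists_measureReal_jumpPath_mem_Icc hij hpos
  obtain ⟨δ₂, hδ₂, hdiag⟩ := exists_half_le_exp_smul_diag_pow Λ
  set T := min (min δ δ') δ₂ with hT
  have hT0 : 0 < T := by positivity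
  obtain ⟨c, hc, hcB⟩ := hB 0 T hT0
    (by rw [sub_zero]; exact (min_le_left _ _).trans (min_le_left _ _))
  have hπ := hX.pos i
  have hu : ∀ n : ℕ, 0 ≤ (T - 0) / 2 ^ n := fun n => div_nonneg (by linarith) (by positivity)
  have hN : ∀ n : ℕ, ((2 ^ n : ℕ) : ℝ) * ((T - 0) / 2 ^ n) = T := fun n => by
    push_cast; field_simp; ring
  have hstay : ∀ n, π i / 2 ≤ P.real (noJump X 0 T i n) := fun n => by
    rw [noJump, hX.measureReal_gridPath 0 (hu n), Finset.prod_const, Finset.card_range]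
    have := mul_le_mul_of_nonneg_left
      (hdiag _ (hu n) (2 ^ n) ((hN n).trans_le (min_le_right _ _)) i) hπ.le
    linarith
  -- The constant `4 Λᵢⱼ T` is the ratio of the upper bound `2 πᵢ Λᵢⱼ T` for the sum of the
  -- probabilities of the paths with one jump to the lower bound `πᵢ / 2` for that of no jump.
  refine not_isInvertible_of_le (B := singleJump X 0 T i j) (B' := noJump X 0 T i)
    (C := 4 * Λ i j * T) (j := j) hX.measurable hX.cadlag continuous_of_discreteTopology
    (measurable_of_countable h) hT0 (hX.measurableSet_singleJump hT0.le i j)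
    (fun n => hX.measurableSet_gridPath_dyadic hT0.le n _) (antitone_singleJump X 0 T i j)
    (antitone_noJump X 0 T i) (by positivity) hc ?_ hcB
    (fun ω hω => apply_eq_of_mem_singleJump hω)
    (fun ω hω => by rw [apply_eq_of_mem_noJump hω]; exact hij)
  intro n G hG
  calc P.real (G ∩ singleJump X 0 T i j n)
      ≤ ∑ m ∈ Finset.Icc 1 (2 ^ n),
          P.real (G ∩ gridPath X 0 ((T - 0) / 2 ^ n) (2 ^ n) (jumpPath i j m)) := by
        rw [singleJump, Set.inter_iUnion₂]
        exact measureReal_biUnion_finset_le _ _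
    _ ≤ ∑ m ∈ Finset.Icc 1 (2 ^ n),
          4 * Λ i j * ((T - 0) / 2 ^ n) * P.real (G ∩ noJump X 0 T i n) := by
        refine Finset.sum_le_sum fun m hm => ?_
        have hm' := Finset.mem_Icc.1 hm
        have hC : 0 ≤ 4 * Λ i j * ((T - 0) / 2 ^ n) := mul_nonneg (by positivity) (hu n)
        refine measureReal_inter_gridPath_le (by simp [jumpPath]; omega) (fun l _ => ?_) hC
          (lt_of_lt_of_le (by positivity) (hstay n)) ?_ hG
        · unfold jumpPath
          split_ifs
          · rfl
          · exact hh.symm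
        · have h1 := (hb 0 _ (hu n) (2 ^ n)
            ((hN n).trans_le ((min_le_left _ _).trans (min_le_right _ _))) m hm).2
          have h2 := mul_le_mul_of_nonneg_left (hstay n) hC
          refine h1.trans (le_trans (le_of_eq ?_) h2)
          ring
    _ = 4 * Λ i j * T * P.real (G ∩ noJump X 0 T i n) := by
        rw [Finset.sum_const, Nat.card_Icc, nsmul_eq_mul, Nat.add_sub_cancel]
        nth_rw 3 [← hN n]
        ring

/-- Two jumps from the same state to states with the same observation cannot be told apart. -/
theorem IsStationaryFiniteMarkov.not_isInvertible_of_ambiguous_jump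
    (hX : IsStationaryFiniteMarkov P X Λ π) {i j k : Fin d} (hij : i ≠ j) (hik : i ≠ k)
    (hjk : j ≠ k) (hposj : 0 < Λ i j) (hposk : 0 < Λ i k) (hh : h j = h k) :
    ¬IsInvertible P X h := by
  obtain ⟨δ, hδ, hB⟩ := hX.exists_le_measureReal_singleJump hij hposj
  obtain ⟨δ', hδ', hbj⟩ := hX.exists_measureReal_jumpPath_mem_Icc hij hposj
  obtain ⟨δ₂, hδ₂, hbk⟩ := hX.exists_measureReal_jumpPath_mem_Icc hik hposk
  set T := min (min δ δ') δ₂ with hT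
  have hT0 : 0 < T := by positivity
  obtain ⟨c, hc, hcB⟩ := hB 0 T hT0
    (by rw [sub_zero]; exact (min_le_left _ _).trans (min_le_left _ _))
  have hπ := hX.pos i
  have hu : ∀ n : ℕ, 0 < (T - 0) / 2 ^ n := fun n => div_pos (by linarith) (by positivity)
  have hN : ∀ n : ℕ, ((2 ^ n : ℕ) : ℝ) * ((T - 0) / 2 ^ n) = T := fun n => by
    push_cast; field_simp; ring
  -- Paths that jump to `j` or to `k` at the same step are compared with each other: at step size
  -- `u` their probabilities are at most `2 πᵢ Λᵢⱼ u` and at least `πᵢ Λᵢₖ u / 8`.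
  refine not_isInvertible_of_le (B := singleJump X 0 T i j) (B' := singleJump X 0 T i k)
    (C := 16 * Λ i j / Λ i k) (j := j) hX.measurable hX.cadlag continuous_of_discreteTopology
    (measurable_of_countable h) hT0 (hX.measurableSet_singleJump hT0.le i j)
    (hX.measurableSet_singleJump hT0.le i k) (antitone_singleJump X 0 T i j)
    (antitone_singleJump X 0 T i k) (by positivity) hc ?_ hcB
    (fun ω hω => apply_eq_of_mem_singleJump hω)
    (fun ω hω => by rw [apply_eq_of_mem_singleJump hω]; exact hjk.symm)
  intro n G hG
  have hG0 := dyadicObs_le hX.measurable (measurable_of_countable h) 0 T n _ hG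
  calc P.real (G ∩ singleJump X 0 T i j n)
      ≤ ∑ m ∈ Finset.Icc 1 (2 ^ n),
          P.real (G ∩ gridPath X 0 ((T - 0) / 2 ^ n) (2 ^ n) (jumpPath i j m)) := by
        rw [singleJump, Set.inter_iUnion₂]
        exact measureReal_biUnion_finset_le _ _
    _ ≤ ∑ m ∈ Finset.Icc 1 (2 ^ n), 16 * Λ i j / Λ i k *
          P.real (G ∩ gridPath X 0 ((T - 0) / 2 ^ n) (2 ^ n) (jumpPath i k m)) := by
        refine Finset.sum_le_sum fun m hm => ?_
        have hm' := Finset.mem_Icc.1 hm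
        have h1 := (hbj 0 _ (hu n).le (2 ^ n)
          ((hN n).trans_le ((min_le_left _ _).trans (min_le_right _ _))) m hm).2
        have h2 := (hbk 0 _ (hu n).le (2 ^ n) ((hN n).trans_le (min_le_right _ _)) m hm).1
        have hun := hu n
        refine measureReal_inter_gridPath_le (by simp only [jumpPath]; split_ifs <;> [rfl; omega])
          (fun l _ => ?_) (by positivity) (lt_of_lt_of_le (by positivity) h2) ?_ hG
        · unfold jumpPath
          split_ifs
          · rfl
          · exact hh
        · have h3 := mul_le_mul_of_nonneg_left h2
            (show 0 ≤ 16 * Λ i j / Λ i k by positivity)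
          refine h1.trans (le_trans (le_of_eq ?_) h3)
          field_simp
          ring
    _ = 16 * Λ i j / Λ i k * P.real (G ∩ singleJump X 0 T i k n) := by
        rw [← Finset.mul_sum, singleJump, Set.inter_iUnion₂,
          measureReal_biUnion_finset
            ((pairwiseDisjoint_gridPath_jumpPath X 0 _ hik _).mono fun _ =>
              Set.inter_subset_right)
            fun m _ => hG0.inter (hX.measurableSet_gridPath_dyadic hT0.le n _)]

end Markov

end FilteringModel

theorem lemma4p2 {Ω : Type*} [MeasurableSpace Ω] (P : Measure Ω) [IsProbabilityMeasure P]
    {d n : ℕ} (X : ℝ → Ω → Fin d) (Λ : Matrix (Fin d) (Fin d) ℝ) (π : Fin d → ℝ)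
    (h : Fin d → EuclideanSpace ℝ (Fin n))
    (hX : FilteringModel.IsStationaryFiniteMarkov P X Λ π) :
    FilteringModel.IsInvertible P X h ↔
      (∀ i j : Fin d, i ≠ j → 0 < Λ i j → h i ≠ h j) ∧
      (∀ i j k : Fin d, i ≠ j → i ≠ k → j ≠ k → 0 < Λ i j → 0 < Λ i k → h j ≠ h k) :=
  ⟨fun hinv => ⟨fun _ _ hij hpos hh => hX.not_isInvertible_of_invisible_jump hij hpos hh hinv,
    fun _ _ _ hij hik hjk hj hk hh =>
      hX.not_isInvertible_of_ambiguous_jump hij hik hjk hj hk hh hinv⟩,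
    fun hc => hX.isInvertible hc.1 hc.2⟩
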